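/- **Setting.** Let $T\ge 1$ and $N\ge 0$ be integers and $\mathbb T=\{1,\dots,T\}$ the set of treatments. A state of nature is a mean vector $\mu\in[0,1]^T$; under $\mu$ the potential outcomes $Y_1,\dots,Y_T\in\{0,1\}$ are independent with $P_\mu(Y_t=1)=\mu_t$. The policymaker observes a sample $w=(t_i,y_i)_{i=1}^N\in(\mathbb T\times\{0,1\})^N$, where $(t_1,\dots,t_N)$ has a given distribution that does not depend on $\mu$ (the sampling design, e.g. fixed or random assignment) and, given $(t_i)_i$, the $y_i$ are independent Bernoulli variables with means $\mu_{t_i}$. A treatment rule is a map $\delta$ from samples to $\Delta^{T-1}=\{x\in[0,1]^T:\sum_t x_t=1\}$. Let $D$ be a finite nonempty set of treatment rules and let $\mathbb D$, the convex hull of $D$, be the set of rules available to the policymaker. For a rule $\delta$ put $$u(\delta,\mu)=E_\mu Y_{B}=\sum_w P_\mu(w)\sum_{t=1}^T\delta_t(w)\,\mu_t,\qquad R(\delta,\mu)=\max_{d\in\mathbb D}u(d,\mu)-u(\delta,\mu),$$ where $B=t$ with probability $\delta_t(w)$ given $w$, independently of $Y$. For a finitely supported $\nu=\sum_m p_m I(\mu_m)$,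 with $I(x)$ the unit point mass at $x$, put $R(\delta,\nu)=\sum_m p_m R(\delta,\mu_m)$. The same formulas are used for arbitrary real-valued $\delta$ and real weights $p_m$. Let $\emptyset\ne M\subset[0,1]^T$, $\varepsilon>0$, and let $M_\varepsilon\subset M$ be an $\varepsilon$-discretization of $M$: a finite subset such that every $\mu\in M$ has some $\mu_\varepsilon\in M_\varepsilon$ with $\|\mu_\varepsilon-\mu\|<\varepsilon$ in the Euclidean norm. The minimax regret value of the discretized game is $$V_\varepsilon=\inf_{\delta\in\mathbb D}\max_{\mu\in M_\varepsilon}R(\delta,\mu).$$ **Algorithm (fictitious play with weights $\alpha_1,\alpha_2,\dots$, run without stopping).** Start with any $\delta^1\in D$ and $\nu^0=0$. For $n=1,2,\dots$: 1. choose any $\mu^n_{BR}\in M_\varepsilon$ with $R(\delta^n,\mu^n_{BR})=\max_{\mu\in M_\varepsilon}R(\delta^n,\mu)$; 2. set $\nu^n=(1-\alpha_n)\nu^{n-1}+\alpha_n I(\mu^n_{BR})$; 3. choose any $\delta^n_{BR}\in D$ with $R(\delta^n_{BR},\nu^n)=\min_{\delta\in D}R(\delta,\nu^n)$; 4. set $\delta^{n+1}=(1-\alpha_{n+1})\delta^n+\alpha_{n+1}\delta^n_{BR}$.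 **Proposition.** Suppose $\alpha_n>0$ for all $n\ge1$, $\alpha_n\to0$ and $\sum_{n=1}^\infty\alpha_n=\infty$. Then, for every sequence $(\delta^n)$ generated by the algorithm, $$\lim_{n\to\infty}\ \max_{\mu\in M_\varepsilon}R(\delta^n,\mu)=V_\varepsilon .$$ -/

import Mathlib

open Filter Topology

namespace MinimaxRegret

noncomputable section

/-- A sample `w = (tᵢ, yᵢ)` of size `N`: observed treatments with binary outcomes. -/
abbrev Sample (T N : ℕ) : Type := Fin N → Fin T × Bool

/-- `T`-vectors attached to the samples. The treatment rules are the members of this space that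
satisfy `IsTreatmentRule`; the ambient vector space is where mixtures of rules are formed. -/
abbrev Rule (T N : ℕ) : Type := Sample T N → Fin T → ℝ

/-- Mean vectors, with the Euclidean norm. -/
abbrev Mean (T : ℕ) : Type := EuclideanSpace ℝ (Fin T)

/-- (Weights of) a finitely supported mixed strategy of nature. -/
abbrev NatureMix (T : ℕ) : Type := Mean T →₀ ℝ

/-- A treatment rule assigns to each sample a probability vector over the treatments. -/
def IsTreatmentRule {T N : ℕ} (δ : Rule T N) : Prop :=
  ∀ w, δ w ∈ stdSimplex ℝ (Fin T)

/-- A success has value one, a failure has value zero. -/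
def outcome (y : Bool) : ℝ := if y then 1 else 0

/-- Bernoulli probability of `y` when the success probability is `p`. -/
def bern (p : ℝ) (y : Bool) : ℝ := if y then p else 1 - p

/-- Probability of the potential outcomes `y ∈ {0,1}^T`: independent Bernoulli marginals with
mean vector `μ`. -/
def stateProb {T : ℕ} (μ : Mean T) (y : Fin T → Bool) : ℝ := ∏ t, bern (μ t) (y t)

/-- Probability of a sample. The sampling design `q` is the distribution of the vector of sampled
treatments `(t₁, …, t_N)`; given these, the outcomes are independent draws from the corresponding
Bernoulli marginals. A point mass `q` is fixed assignment, a product distribution `q` is random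
assignment, and a `q` that never samples a given treatment of known mean (fixed through the set
of mean vectors) is testing innovations. -/
def sampleProb {T N : ℕ} (q : (Fin N → Fin T) → ℝ) (μ : Mean T) (w : Sample T N) : ℝ :=
  q (fun i => (w i).1) * ∏ i, bern (μ (w i).1) (w i).2

/-- Expected outcome `E Y_B`: draw the sample `w`, then the treatment `b` with probabilities
`δ w`, and independently the potential outcomes `y`. -/
def payoff {T N : ℕ} (q : (Fin N → Fin T) → ℝ) (δ : Rule T N) (μ : Mean T) : ℝ :=
  ∑ w, sampleProb q μ w * ∑ b, δ w b * ∑ y : Fin T → Bool, stateProb μ y * outcome (y b)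

/-- Regret relative to the set `𝔻` of available rules. -/
def regret {T N : ℕ} (q : (Fin N → Fin T) → ℝ) (𝔻 : Set (Rule T N)) (δ : Rule T N)
    (μ : Mean T) : ℝ :=
  sSup ((fun d => payoff q d μ) '' 𝔻) - payoff q δ μ

/-- Regret against a mixed strategy of nature. -/
def mixedRegret {T N : ℕ} (q : (Fin N → Fin T) → ℝ) (𝔻 : Set (Rule T N)) (δ : Rule T N)
    (ν : NatureMix T) : ℝ :=
  ν.sum fun μ c => c * regret q 𝔻 δ μ

/-- Maximal regret over a finite set of mean vectors. -/
def maxRegret {T N : ℕ} (q : (Fin N → Fin T) → ℝ) (𝔻 : Set (Rule T N)) (Mε : Finset (Mean T))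
    (δ : Rule T N) : ℝ :=
  sSup ((fun μ => regret q 𝔻 δ μ) '' (Mε : Set (Mean T)))

/-- Minimax regret value of the game in which nature is restricted to `Mε`. -/
def minimaxRegretValue {T N : ℕ} (q : (Fin N → Fin T) → ℝ) (𝔻 : Set (Rule T N))
    (Mε : Finset (Mean T)) : ℝ :=
  sInf ((fun δ => maxRegret q 𝔻 Mε δ) '' 𝔻)

/-- A finite subset of `M` that comes within distance less than `ε` of each point of `M`. -/
def IsDiscretization {T : ℕ} (M : Set (Mean T)) (ε : ℝ) (Mε : Finset (Mean T)) : Prop :=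
  (Mε : Set (Mean T)) ⊆ M ∧ ∀ μ ∈ M, ∃ μ' ∈ Mε, ‖μ' - μ‖ < ε

/-- A run of the fictitious-play algorithm with weights `α₁, α₂, …`, without the break command.
Best responses are arbitrary maximizers (minimizers); the values `δ 0`, `μBR 0`, `δBR 0` and
`α 0` play no role. -/
structure IsRun {T N : ℕ} (q : (Fin N → Fin T) → ℝ) (𝔻 : Set (Rule T N))
    (D : Finset (Rule T N)) (Mε : Finset (Mean T)) (α : ℕ → ℝ)
    (δ : ℕ → Rule T N) (ν : ℕ → NatureMix T) (μBR : ℕ → Mean T) (δBR : ℕ → Rule T N) :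
    Prop where
  init_rule : δ 1 ∈ D
  init_nature : ν 0 = 0
  nature_mem : ∀ n, 1 ≤ n → μBR n ∈ Mε
  nature_best : ∀ n, 1 ≤ n → ∀ μ ∈ Mε, regret q 𝔻 (δ n) μ ≤ regret q 𝔻 (δ n) (μBR n)
  nature_update : ∀ n, 1 ≤ n →
    ν n = (1 - α n) • ν (n - 1) + α n • Finsupp.single (μBR n) (1 : ℝ)
  rule_mem : ∀ n, 1 ≤ n → δBR n ∈ D
  rule_best : ∀ n, 1 ≤ n → ∀ d ∈ D,
    mixedRegret q 𝔻 (δBR n) (ν n) ≤ mixedRegret q 𝔻 d (ν n)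
  rule_update : ∀ n, 1 ≤ n → δ (n + 1) = (1 - α (n + 1)) • δ n + α (n + 1) • δBR n

end

end MinimaxRegret

open Filter Topology

/-! This is Robinson's argument for fictitious play, with weights. Nature is the row maximizer on
`Mε`, the policymaker the column minimizer on `D`. The gap is the maximal regret of δⁿ minus the
least regret against νⁿ. Once it vanishes, any d in the hull satisfies, up to o(1), max R(δⁿ,·) ≤
min_D R(·,νⁿ) ≤ R(d,νⁿ) ≤ max R(d,·). With d nearly optimal this is the upper bound; no minimax
theorem is needed. The lower bound holds because δⁿ is asymptotically in the hull.

The gap vanishes by `eventually_gap_le`. Division by the product of the factors 1 - α turns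
averaging into adding payoffs with weights, and `exists_gap_bound` bounds the added gap by a small
multiple of the total weight plus a multiple of the largest weight. Its proof is an induction on the
number of strategies. Take a final window of rounds of suitable weight. If every strategy is optimal
at some time in it, weak duality (`exists_gap_le`) bounds the gap whatever the history; otherwise an
idle strategy is deleted and the smaller game bounds the growth over the window.

Early weights may exceed 1 and ν⁰ = 0, so early rules may leave the hull and νⁿ need not be a
probability. These defects fade, since the product of the 1 - α tends to 0 when ∑ α diverges. -/

namespace MinimaxRegret

/-! ### Weighted play with additive scores -/

/-- `n` rounds of unnormalised fictitious play with weights `β t ∈ (0, b]` in the zero-sum game `A`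
restricted to the strategies `I` of the maximizer and `J` of the minimizer. The scores `V` of the
maximizer and `U` of the minimizer start anywhere; the minimizer moves first in each round. -/
structure IsWeightedPlay {ι κ : Type*} (A : ι → κ → ℝ) (I : Finset ι) (J : Finset κ) (b : ℝ)
    (n : ℕ) (V : ℕ → ι → ℝ) (U : ℕ → κ → ℝ) (β : ℕ → ℝ) (i : ℕ → ι) (j : ℕ → κ) : Prop where
  weight_pos : ∀ t < n, 0 < β t
  weight_le : ∀ t < n, β t ≤ b
  col_mem : ∀ t < n, j t ∈ J
  col_best : ∀ t < n, ∀ l ∈ J, U t (j t) ≤ U t l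
  row_mem : ∀ t < n, i t ∈ I
  row_best : ∀ t < n, ∀ k ∈ I, V (t + 1) k ≤ V (t + 1) (i t)
  row_update : ∀ t < n, ∀ k ∈ I, V (t + 1) k = V t k + β t * A k (j t)
  col_update : ∀ t < n, ∀ l ∈ J, U (t + 1) l = U t l + β t * A (i t) l

namespace IsWeightedPlay

variable {ι κ : Type*} {A : ι → κ → ℝ} {I : Finset ι} {J : Finset κ} {b : ℝ} {n : ℕ}
  {V : ℕ → ι → ℝ} {U : ℕ → κ → ℝ} {β : ℕ → ℝ} {i : ℕ → ι} {j : ℕ → κ}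

lemma truncate (h : IsWeightedPlay A I J b n V U β i j) {s : ℕ} (hs : s ≤ n) :
    IsWeightedPlay A I J b s V U β i j where
  weight_pos t ht := h.weight_pos t (by omega)
  weight_le t ht := h.weight_le t (by omega)
  col_mem t ht := h.col_mem t (by omega)
  col_best t ht := h.col_best t (by omega)
  row_mem t ht := h.row_mem t (by omega)
  row_best t ht := h.row_best t (by omega)
  row_update t ht := h.row_update t (by omega)
  col_update t ht := h.col_update t (by omega)

lemma shift (h : IsWeightedPlay A I J b n V U β i j) {s : ℕ} (hs : s ≤ n) :
    IsWeightedPlay A I J b (n - s) (fun t => V (s + t)) (fun t => U (s + t)) (fun t => β (s + t))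
      (fun t => i (s + t)) (fun t => j (s + t)) where
  weight_pos t ht := h.weight_pos (s + t) (by omega)
  weight_le t ht := h.weight_le (s + t) (by omega)
  col_mem t ht := h.col_mem (s + t) (by omega)
  col_best t ht := h.col_best (s + t) (by omega)
  row_mem t ht := h.row_mem (s + t) (by omega)
  row_best t ht := h.row_best (s + t) (by omega)
  row_update t ht := h.row_update (s + t) (by omega)
  col_update t ht := h.col_update (s + t) (by omega)

/-- A row that is never optimal can be deleted. -/
lemma erase_row [DecidableEq ι] (h : IsWeightedPlay A I J b n V U β i j) {k : ι}
    (hk : ∀ t ≤ n, ∃ k' ∈ I, V t k < V t k') :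
    IsWeightedPlay A (I.erase k) J b n V U β i j where
  weight_pos := h.weight_pos
  weight_le := h.weight_le
  col_mem := h.col_mem
  col_best := h.col_best
  row_mem t ht := by
    refine Finset.mem_erase.2 ⟨?_, h.row_mem t ht⟩
    rintro rfl
    obtain ⟨k', hk', hlt⟩ := hk (t + 1) ht
    exact absurd (h.row_best t ht k' hk') (not_le.2 hlt)
  row_best t ht k' hk' := h.row_best t ht k' (Finset.mem_of_mem_erase hk')
  row_update t ht k' hk' := h.row_update t ht k' (Finset.mem_of_mem_erase hk')
  col_update := h.col_update

/-- A column that is never optimal can be deleted. -/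
lemma erase_col [DecidableEq κ] (h : IsWeightedPlay A I J b n V U β i j) {l : κ}
    (hl : ∀ t ≤ n, ∃ l' ∈ J, U t l' < U t l) :
    IsWeightedPlay A I (J.erase l) b n V U β i j where
  weight_pos := h.weight_pos
  weight_le := h.weight_le
  col_mem t ht := by
    refine Finset.mem_erase.2 ⟨?_, h.col_mem t ht⟩
    rintro rfl
    obtain ⟨l', hl', hlt⟩ := hl t ht.le
    exact absurd (h.col_best t ht l' hl') (not_le.2 hlt)
  col_best t ht l' hl' := h.col_best t ht l' (Finset.mem_of_mem_erase hl')
  row_mem := h.row_mem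
  row_best := h.row_best
  row_update := h.row_update
  col_update t ht l' hl' := h.col_update t ht l' (Finset.mem_of_mem_erase hl')

lemma row_eq_sum (h : IsWeightedPlay A I J b n V U β i j) {k : ι} (hk : k ∈ I) :
    V n k = V 0 k + ∑ t ∈ Finset.range n, β t * A k (j t) := by
  induction n with
  | zero => simp
  | succ n ih =>
    rw [h.row_update n n.lt_succ_self k hk, ih (h.truncate n.le_succ), Finset.sum_range_succ]
    ring

lemma col_eq_sum (h : IsWeightedPlay A I J b n V U β i j) {l : κ} (hl : l ∈ J) :
    U n l = U 0 l + ∑ t ∈ Finset.range n, β t * A (i t) l := by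
  induction n with
  | zero => simp
  | succ n ih =>
    rw [h.col_update n n.lt_succ_self l hl, ih (h.truncate n.le_succ), Finset.sum_range_succ]
    ring

lemma sum_nonneg (h : IsWeightedPlay A I J b n V U β i j) :
    0 ≤ ∑ t ∈ Finset.range n, β t :=
  Finset.sum_nonneg fun t ht => (h.weight_pos t (Finset.mem_range.1 ht)).le

lemma abs_row_sub_le (h : IsWeightedPlay A I J b n V U β i j) {a : ℝ}
    (ha : ∀ k ∈ I, ∀ l ∈ J, |A k l| ≤ a) {k : ι} (hk : k ∈ I) :
    |V n k - V 0 k| ≤ a * ∑ t ∈ Finset.range n, β t := by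
  rw [h.row_eq_sum hk, add_sub_cancel_left, Finset.mul_sum]
  refine (Finset.abs_sum_le_sum_abs _ _).trans (Finset.sum_le_sum fun t ht => ?_)
  have ht := Finset.mem_range.1 ht
  rw [abs_mul, abs_of_pos (h.weight_pos t ht), mul_comm]
  exact mul_le_mul_of_nonneg_right (ha k hk _ (h.col_mem t ht)) (h.weight_pos t ht).le

lemma abs_col_sub_le (h : IsWeightedPlay A I J b n V U β i j) {a : ℝ}
    (ha : ∀ k ∈ I, ∀ l ∈ J, |A k l| ≤ a) {l : κ} (hl : l ∈ J) :
    |U n l - U 0 l| ≤ a * ∑ t ∈ Finset.range n, β t := by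
  rw [h.col_eq_sum hl, add_sub_cancel_left, Finset.mul_sum]
  refine (Finset.abs_sum_le_sum_abs _ _).trans (Finset.sum_le_sum fun t ht => ?_)
  have ht := Finset.mem_range.1 ht
  rw [abs_mul, abs_of_pos (h.weight_pos t ht), mul_comm]
  exact mul_le_mul_of_nonneg_right (ha _ (h.row_mem t ht) l hl) (h.weight_pos t ht).le

/-- Weak duality: the smallest row score exceeds the largest column score by no more than the
initial gap. -/
lemma exists_gap_le (h : IsWeightedPlay A I J b n V U β i j) (hI : I.Nonempty) (hJ : J.Nonempty)
    {c : ℝ} (hc : ∀ k ∈ I, ∀ l ∈ J, V 0 k - U 0 l ≤ c) :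
    ∃ k ∈ I, ∃ l ∈ J, V n k - U n l ≤ c := by
  rcases Nat.eq_zero_or_pos n with rfl | hn
  · obtain ⟨k, hk⟩ := hI
    obtain ⟨l, hl⟩ := hJ
    exact ⟨k, hk, l, hl, hc k hk l hl⟩
  by_contra! hgap
  -- Averaged over the play itself, both players' accumulated payoffs are the same double sum and
  -- cancel, so the mean gap never changes.
  have hswap : ∑ t ∈ Finset.range n, β t * ∑ s ∈ Finset.range n, β s * A (i t) (j s)
      = ∑ t ∈ Finset.range n, β t * ∑ s ∈ Finset.range n, β s * A (i s) (j t) := by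
    simp only [Finset.mul_sum]
    rw [Finset.sum_comm]
    exact Finset.sum_congr rfl fun t _ => Finset.sum_congr rfl fun s _ => by ring
  have heq : ∑ t ∈ Finset.range n, β t * (V n (i t) - U n (j t))
      = ∑ t ∈ Finset.range n, β t * (V 0 (i t) - U 0 (j t)) := by
    have : ∀ t ∈ Finset.range n, β t * (V n (i t) - U n (j t))
        = β t * (V 0 (i t) - U 0 (j t))
          + (β t * (∑ s ∈ Finset.range n, β s * A (i t) (j s))
            - β t * ∑ s ∈ Finset.range n, β s * A (i s) (j t)) := fun t ht => by
      have ht := Finset.mem_range.1 ht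
      rw [h.row_eq_sum (h.row_mem t ht), h.col_eq_sum (h.col_mem t ht)]
      ring
    rw [Finset.sum_congr rfl this, Finset.sum_add_distrib, Finset.sum_sub_distrib, hswap,
      sub_self, add_zero]
  have hlt : ∑ t ∈ Finset.range n, β t * (V 0 (i t) - U 0 (j t))
      < ∑ t ∈ Finset.range n, β t * (V n (i t) - U n (j t)) := by
    refine Finset.sum_lt_sum_of_nonempty ⟨0, Finset.mem_range.2 hn⟩ fun t ht => ?_
    have ht := Finset.mem_range.1 ht
    exact mul_lt_mul_of_pos_left ((hc _ (h.row_mem t ht) _ (h.col_mem t ht)).trans_lt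
      (hgap _ (h.row_mem t ht) _ (h.col_mem t ht))) (h.weight_pos t ht)
  exact hlt.ne' heq

lemma sum_shift_le (h : IsWeightedPlay A I J b n V U β i j) {s t : ℕ} (hst : s ≤ t) :
    ∑ r ∈ Finset.range (n - t), β (t + r) ≤ ∑ r ∈ Finset.range (n - s), β (s + r) := by
  rw [← Finset.sum_Ico_eq_sum_range, ← Finset.sum_Ico_eq_sum_range]
  exact Finset.sum_le_sum_of_subset_of_nonneg (Finset.Ico_subset_Ico_left hst)
    fun r hr _ => (h.weight_pos r (Finset.mem_Ico.1 hr).2).le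

/-- If every row and every column is optimal at some time between `s` and `n`, then the gap at
time `n` is controlled by the weight of these rounds. -/
lemma gap_le_of_all_eligible (h : IsWeightedPlay A I J b n V U β i j) {a c : ℝ} (ha0 : 0 ≤ a)
    (ha : ∀ k ∈ I, ∀ l ∈ J, |A k l| ≤ a) (hc : ∀ k ∈ I, ∀ l ∈ J, V 0 k - U 0 l ≤ c) {s : ℕ}
    (hrow : ∀ k ∈ I, ∃ t, s ≤ t ∧ t ≤ n ∧ ∀ k' ∈ I, V t k' ≤ V t k)
    (hcol : ∀ l ∈ J, ∃ t, s ≤ t ∧ t ≤ n ∧ ∀ l' ∈ J, U t l ≤ U t l')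
    {k : ι} (hk : k ∈ I) {l : κ} (hl : l ∈ J) :
    V n k - U n l ≤ c + 4 * a * ∑ r ∈ Finset.range (n - s), β (s + r) := by
  -- Going back from `n` to a time when `k'` is optimal and forward again costs `2 * a` times the
  -- window weight; the column costs as much.
  obtain ⟨k', hk', l', hl', hgap⟩ := h.exists_gap_le ⟨k, hk⟩ ⟨l, hl⟩ hc
  obtain ⟨t, hst, htn, ht⟩ := hrow k' hk'
  obtain ⟨u, hsu, hun, hu⟩ := hcol l' hl'
  have ht := ht k hk
  have hu := hu l hl
  have hWt := mul_le_mul_of_nonneg_left (h.sum_shift_le hst) ha0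
  have hWu := mul_le_mul_of_nonneg_left (h.sum_shift_le hsu) ha0
  have h1 := abs_le.1 ((h.shift htn).abs_row_sub_le ha hk)
  have h2 := abs_le.1 ((h.shift htn).abs_row_sub_le ha hk')
  have h3 := abs_le.1 ((h.shift hun).abs_col_sub_le ha hl)
  have h4 := abs_le.1 ((h.shift hun).abs_col_sub_le ha hl')
  simp only [Nat.add_sub_cancel' htn, Nat.add_sub_cancel' hun, add_zero] at h1 h2 h3 h4
  linarith [h1.2, h2.1, h3.1, h4.2]

/-- The last stretch of rounds whose weight reaches a given level exceeds it by at most `b`. -/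
lemma exists_window (h : IsWeightedPlay A I J b n V U β i j) {L : ℝ}
    (hn : 0 < n) (hL : L ≤ ∑ t ∈ Finset.range n, β t) :
    ∃ s < n, L ≤ ∑ r ∈ Finset.range (n - s), β (s + r) ∧
      (∑ r ∈ Finset.range (n - s), β (s + r) ≤ max L 0 + b) := by
  induction n generalizing V U β i j with
  | zero => exact absurd hn (lt_irrefl _)
  | succ n ih =>
    have hsplit : ∑ t ∈ Finset.range (n + 1), β t = β 0 + ∑ t ∈ Finset.range n, β (1 + t) := by
      rw [Finset.sum_range_succ', add_comm]
      simp only [add_comm 1]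
    by_cases hcase : 0 < n ∧ L ≤ ∑ t ∈ Finset.range n, β (1 + t)
    · obtain ⟨s, hs, h1, h2⟩ := ih (by simpa using h.shift (s := 1) (by omega)) hcase.1 hcase.2
      refine ⟨1 + s, by omega, ?_, ?_⟩ <;>
        simpa [show n + 1 - (1 + s) = n - s by omega, add_assoc] using (by assumption)
    · refine ⟨0, hn, by simpa using hL, ?_⟩
      have hb := h.weight_le 0 hn
      simp only [Nat.sub_zero, zero_add, hsplit]
      rcases Nat.eq_zero_or_pos n with rfl | hn'
      · simpa using hb.trans (le_add_of_nonneg_left (le_max_right L 0))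
      · have : ∑ t ∈ Finset.range n, β (1 + t) < L := by
          by_contra! hcon
          exact hcase ⟨hn', hcon⟩
        linarith [le_max_left L 0]

end IsWeightedPlay

/-! ### Robinson's induction on the number of strategies -/

/-- The gap of weighted fictitious play grows at an arbitrarily small rate, up to a multiple of the
largest weight. -/
theorem exists_gap_bound {ι κ : Type*} (A : ι → κ → ℝ) (I : Finset ι) (J : Finset κ) (ε : ℝ)
    (hε : 0 < ε) :
    ∃ C : ℝ, 0 ≤ C ∧ ∀ (b : ℝ) (n : ℕ) (V : ℕ → ι → ℝ) (U : ℕ → κ → ℝ) (β : ℕ → ℝ)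
      (i : ℕ → ι) (j : ℕ → κ), 0 < b → IsWeightedPlay A I J b n V U β i j →
      ∀ c, (∀ k ∈ I, ∀ l ∈ J, V 0 k - U 0 l ≤ c) →
      ∀ k ∈ I, ∀ l ∈ J, V n k - U n l ≤ c + ε * ∑ t ∈ Finset.range n, β t + C * b := by
  classical
  -- No base case is needed: with `I` or `J` empty the claim is vacuous.
  induction hm : I.card + J.card using Nat.strong_induction_on generalizing I J ε with
  | _ m ih =>
  subst hm
  have hε2 : 0 < ε / 2 := half_pos hε
  have hrows : ∀ k ∈ I, _ := fun k hk =>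
    ih ((I.erase k).card + J.card) (by have := Finset.card_erase_lt_of_mem hk; omega)
      (I.erase k) J (ε / 2) hε2 rfl
  have hcols : ∀ l ∈ J, _ := fun l hl =>
    ih (I.card + (J.erase l).card) (by have := Finset.card_erase_lt_of_mem hl; omega)
      I (J.erase l) (ε / 2) hε2 rfl
  choose! CI hCI0 hCI using hrows
  choose! CJ hCJ0 hCJ using hcols
  set C' : ℝ := ∑ k ∈ I, CI k + ∑ l ∈ J, CJ l with hC'
  have hC'0 : 0 ≤ C' := add_nonneg (Finset.sum_nonneg hCI0) (Finset.sum_nonneg hCJ0)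
  have hCIle : ∀ k ∈ I, CI k ≤ C' := fun k hk =>
    (Finset.single_le_sum hCI0 hk).trans (le_add_of_nonneg_right (Finset.sum_nonneg hCJ0))
  have hCJle : ∀ l ∈ J, CJ l ≤ C' := fun l hl =>
    (Finset.single_le_sum hCJ0 hl).trans (le_add_of_nonneg_left (Finset.sum_nonneg hCI0))
  set a : ℝ := ∑ k ∈ I, ∑ l ∈ J, |A k l| with ha_def
  have ha0 : 0 ≤ a := Finset.sum_nonneg fun k _ => Finset.sum_nonneg fun l _ => abs_nonneg _
  have ha : ∀ k ∈ I, ∀ l ∈ J, |A k l| ≤ a := fun k hk l hl =>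
    (Finset.single_le_sum (f := fun l => |A k l|) (fun l _ => abs_nonneg _) hl).trans
      (Finset.single_le_sum (f := fun k => ∑ l ∈ J, |A k l|)
        (fun k _ => Finset.sum_nonneg fun l _ => abs_nonneg _) hk)
  -- A window of weight at least `K * b` absorbs the error `C' * b` of a smaller game into the
  -- unused half of `ε`.
  set K : ℝ := 2 * C' / ε with hK
  have hK0 : 0 ≤ K := by positivity
  have hKε : ε / 2 * K = C' := by rw [hK]; field_simp
  refine ⟨4 * a * (K + 1), by positivity, fun b n V U β i j hb h c hc => ?_⟩
  induction n using Nat.strong_induction_on with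
  | _ n ihn =>
  intro k hk l hl
  have hB := h.sum_nonneg
  have hεB : 0 ≤ ε * ∑ t ∈ Finset.range n, β t := by positivity
  by_cases hsmall : n = 0 ∨ ∑ t ∈ Finset.range n, β t < K * b
  -- With little total weight the scores have hardly moved.
  · have h1 := abs_le.1 (h.abs_row_sub_le ha hk)
    have h2 := abs_le.1 (h.abs_col_sub_le ha hl)
    have h3 : a * ∑ t ∈ Finset.range n, β t ≤ a * (K * b) := by
      rcases hsmall with rfl | hlt
      · simpa using by positivity
      · exact mul_le_mul_of_nonneg_left hlt.le ha0
    have h4 := hc k hk l hl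
    have h5 : 0 ≤ a * (K * b) := by positivity
    have h6 : 0 ≤ a * b := by positivity
    linarith [h1.2, h2.1]
  · push Not at hsmall
    obtain ⟨s, hs, hWL, hWU⟩ := h.exists_window (Nat.pos_of_ne_zero hsmall.1) hsmall.2
    rw [max_eq_left (by positivity)] at hWU
    have hsum : ∑ t ∈ Finset.range n, β t
        = ∑ t ∈ Finset.range s, β t + ∑ r ∈ Finset.range (n - s), β (s + r) := by
      rw [← Finset.sum_Ico_eq_sum_range, Finset.sum_range_add_sum_Ico _ hs.le]
    -- Closes both deletion cases: the gap at `s` from the inner induction plus the growth in the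
    -- smaller game.
    have hsub : ∀ C₀ ≤ C', ∀ x : ℝ, x ≤ (c + ε * ∑ t ∈ Finset.range s, β t + 4 * a * (K + 1) * b)
          + ε / 2 * ∑ r ∈ Finset.range (n - s), β (s + r) + C₀ * b →
        x ≤ c + ε * ∑ t ∈ Finset.range n, β t + 4 * a * (K + 1) * b := by
      intro C₀ hC₀ x hx
      have h1 : C₀ * b ≤ C' * b := mul_le_mul_of_nonneg_right hC₀ hb.le
      have h2 : C' * b ≤ ε / 2 * ∑ r ∈ Finset.range (n - s), β (s + r) := by
        rw [← hKε, mul_assoc]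
        exact mul_le_mul_of_nonneg_left hWL hε2.le
      rw [hsum, mul_add]
      linarith
    have hgap_s := ihn s hs (h.truncate hs.le)
    by_cases hrow : ∀ k ∈ I, ∃ t, s ≤ t ∧ t ≤ n ∧ ∀ k' ∈ I, V t k' ≤ V t k
    · by_cases hcol : ∀ l ∈ J, ∃ t, s ≤ t ∧ t ≤ n ∧ ∀ l' ∈ J, U t l ≤ U t l'
      · have h1 := h.gap_le_of_all_eligible ha0 ha hc hrow hcol hk hl
        have h2 : 4 * a * ∑ r ∈ Finset.range (n - s), β (s + r) ≤ 4 * a * (K * b + b) :=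
          mul_le_mul_of_nonneg_left hWU (by positivity)
        linarith
      · push Not at hcol
        obtain ⟨l₀, hl₀, hcol⟩ := hcol
        have hplay := (h.shift hs.le).erase_col (l := l₀)
          fun t ht => hcol (s + t) (by omega) (by omega)
        have hb₀ := hCJ l₀ hl₀ b _ _ _ _ _ _ hb hplay _
          (fun k hk l hl => hgap_s k hk l (Finset.mem_of_mem_erase hl))
        simp only [Nat.add_sub_cancel' hs.le] at hb₀
        -- The deleted column is not optimal at time `n`, so a remaining column has a larger gap.
        by_cases hll : l = l₀
        · subst hll
          obtain ⟨l', hl', hlt⟩ := hcol n hs.le le_rfl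
          have hne : l' ≠ l := by rintro rfl; exact lt_irrefl _ hlt
          have := hsub _ (hCJle l hl) _ (hb₀ k hk l' (Finset.mem_erase.2 ⟨hne, hl'⟩))
          linarith
        · exact hsub _ (hCJle l₀ hl₀) _ (hb₀ k hk l (Finset.mem_erase.2 ⟨hll, hl⟩))
    · push Not at hrow
      obtain ⟨k₀, hk₀, hrow⟩ := hrow
      have hplay := (h.shift hs.le).erase_row (k := k₀)
        fun t ht => hrow (s + t) (by omega) (by omega)
      have hb₀ := hCI k₀ hk₀ b _ _ _ _ _ _ hb hplay _
        (fun k hk l hl => hgap_s k (Finset.mem_of_mem_erase hk) l hl)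
      simp only [Nat.add_sub_cancel' hs.le] at hb₀
      by_cases hkk : k = k₀
      · subst hkk
        obtain ⟨k', hk', hlt⟩ := hrow n hs.le le_rfl
        have hne : k' ≠ k := by rintro rfl; exact lt_irrefl _ hlt
        have := hsub _ (hCIle k hk) _ (hb₀ k' (Finset.mem_erase.2 ⟨hne, hk'⟩) l hl)
        linarith
      · exact hsub _ (hCIle k₀ hk₀) _ (hb₀ k (Finset.mem_erase.2 ⟨hkk, hk⟩) l hl)

/-! ### From averaging to additive weights -/

/-- The weight that the state at time `m` retains after `t` further averaging steps. -/
noncomputable def retention (α : ℕ → ℝ) (m t : ℕ) : ℝ := ∏ s ∈ Finset.range t, (1 - α (m + s + 1))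

lemma retention_succ (α : ℕ → ℝ) (m t : ℕ) :
    retention α m (t + 1) = (1 - α (m + t + 1)) * retention α m t := by
  rw [retention, Finset.prod_range_succ, mul_comm]
  rfl

lemma retention_pos {α : ℕ → ℝ} {m : ℕ} (hα : ∀ n, m ≤ n → α n < 1) (t : ℕ) :
    0 < retention α m t :=
  Finset.prod_pos fun s _ => sub_pos.2 (hα _ (by omega))

lemma retention_antitone {α : ℕ → ℝ} {m : ℕ} (hα0 : ∀ n, m ≤ n → 0 < α n)
    (hα : ∀ n, m ≤ n → α n < 1) : Antitone (retention α m) :=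
  antitone_nat_of_succ_le fun t => by
    rw [retention_succ]
    exact mul_le_of_le_one_left (retention_pos hα t).le
      (by linarith [hα0 (m + t + 1) (by omega)])

/-- The product is at most exp(-∑ α), because 1 - x ≤ exp(-x). -/
lemma tendsto_retention {α : ℕ → ℝ} (hα : Tendsto (fun n => ∑ k ∈ Finset.Icc 1 n, α k) atTop atTop)
    {m : ℕ} (hα1 : ∀ n, m ≤ n → α n < 1) : Tendsto (retention α m) atTop (𝓝 0) := by
  have hsum : ∀ t, ∑ s ∈ Finset.range t, α (m + s + 1)
      = ∑ k ∈ Finset.Icc 1 (m + t), α k - ∑ k ∈ Finset.Icc 1 m, α k := by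
    intro t
    induction t with
    | zero => simp
    | succ t ih =>
      rw [Finset.sum_range_succ, ih, ← add_assoc m t 1, Finset.sum_Icc_succ_top (by omega)]
      ring
  have htop : Tendsto (fun t => ∑ s ∈ Finset.range t, α (m + s + 1)) atTop atTop := by
    simp only [hsum, sub_eq_add_neg]
    exact tendsto_atTop_add_const_right _ _
      (hα.comp (tendsto_atTop_mono (fun t => Nat.le_add_left t m) tendsto_id))
  refine squeeze_zero (fun t => (retention_pos hα1 t).le) (fun t => ?_)
    (Real.tendsto_exp_atBot.comp (tendsto_neg_atTop_atBot.comp htop))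
  simp only [Function.comp_apply, retention, ← Finset.sum_neg_distrib, Real.exp_sum]
  refine Finset.prod_le_prod (fun s _ => (sub_pos.2 (hα1 _ (by omega))).le) fun s _ => ?_
  linarith [Real.add_one_le_exp (-α (m + s + 1))]

/-- Fictitious play with vanishing, non-summable averaging weights closes the gap between the
scores of the two players. -/
theorem eventually_gap_le {ι κ : Type*} (A : ι → κ → ℝ) (I : Finset ι) (J : Finset κ)
    (α : ℕ → ℝ) (hαpos : ∀ n, 1 ≤ n → 0 < α n) (hαlim : Tendsto α atTop (𝓝 0))
    (hαsum : Tendsto (fun n => ∑ k ∈ Finset.Icc 1 n, α k) atTop atTop)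
    (f : ℕ → ι → ℝ) (g : ℕ → κ → ℝ) (i : ℕ → ι) (j : ℕ → κ)
    (hi : ∀ n, 1 ≤ n → i n ∈ I) (hibest : ∀ n, 1 ≤ n → ∀ k ∈ I, f n k ≤ f n (i n))
    (hj : ∀ n, 1 ≤ n → j n ∈ J) (hjbest : ∀ n, 1 ≤ n → ∀ l ∈ J, g n (j n) ≤ g n l)
    (hf : ∀ n, 1 ≤ n → ∀ k, f (n + 1) k = (1 - α (n + 1)) * f n k + α (n + 1) * A k (j n))
    (hg : ∀ n, 1 ≤ n → ∀ l,
      g (n + 1) l = (1 - α (n + 1)) * g n l + α (n + 1) * A (i (n + 1)) l)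
    {ε : ℝ} (hε : 0 < ε) :
    ∀ᶠ n in atTop, ∀ k ∈ I, ∀ l ∈ J, f n k - g n l ≤ ε := by
  obtain ⟨C, hC0, hC⟩ := exists_gap_bound A I J (ε / 3) (by positivity)
  -- The bound 1/2 keeps the factors 1 - α positive; the other makes the error term `C * η` at most
  -- `ε / 3`.
  set η : ℝ := min (1 / 2) (ε / 3 / (C + 1)) with hη
  have hη0 : 0 < η := by positivity
  have hCη : C * η ≤ ε / 3 := by
    have h1 : (C + 1) * η ≤ (C + 1) * (ε / 3 / (C + 1)) :=
      mul_le_mul_of_nonneg_left (min_le_right _ _) (by positivity)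
    rw [mul_div_cancel₀ _ (by positivity)] at h1
    linarith
  obtain ⟨m₀, hm₀⟩ := eventually_atTop.1 (hαlim.eventually (gt_mem_nhds hη0))
  set m := m₀ + 1 with hm
  have hαη : ∀ n, m ≤ n → α n < η := fun n hn => hm₀ n (by omega)
  have hα1 : ∀ n, m ≤ n → α n < 1 := fun n hn =>
    (hαη n hn).trans_le ((min_le_left _ _).trans (by norm_num))
  have hα0 : ∀ n, m ≤ n → 0 < α n := fun n hn => hαpos n (by omega)
  set Q := retention α m with hQ
  have hQpos : ∀ t, 0 < Q t := retention_pos hα1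
  have hQanti : Antitone Q := retention_antitone hα0 hα1
  have hQsucc : ∀ t, Q (t + 1) = (1 - α (m + t + 1)) * Q t := retention_succ α m
  have hQ0 : Q 0 = 1 := by simp [hQ, retention]
  -- The row index is one ahead of the column index: nature answers the rule formed from the latest
  -- column choice. The weight bound `η / Q n` depends on the horizon, hence a constant `C`
  -- independent of `b`.
  have hplay : ∀ n, IsWeightedPlay A I J (η / Q n) n (fun t k => f (m + t) k / Q t)
      (fun t l => g (m + t) l / Q t) (fun t => α (m + t + 1) / Q (t + 1))
      (fun t => i (m + t + 1)) (fun t => j (m + t)) := fun n =>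
    { weight_pos := fun t _ => div_pos (hα0 _ (by omega)) (hQpos _)
      weight_le := fun t ht => div_le_div₀ hη0.le (hαη _ (by omega)).le (hQpos n) (hQanti ht)
      col_mem := fun t _ => hj _ (by omega)
      col_best := fun t _ l hl =>
        div_le_div_of_nonneg_right (hjbest _ (by omega) l hl) (hQpos t).le
      row_mem := fun t _ => hi _ (by omega)
      row_best := fun t _ k hk =>
        div_le_div_of_nonneg_right (hibest _ (by omega) k hk) (hQpos (t + 1)).le
      row_update := fun t _ k _ => by
        have h1 := (hQpos t).ne'
        have h2 : 1 - α (m + t + 1) ≠ 0 := (sub_pos.2 (hα1 _ (by omega))).ne'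
        simp only [← add_assoc]
        rw [hf (m + t) (by omega), hQsucc]
        field_simp
      col_update := fun t _ l _ => by
        have h1 := (hQpos t).ne'
        have h2 : 1 - α (m + t + 1) ≠ 0 := (sub_pos.2 (hα1 _ (by omega))).ne'
        simp only [← add_assoc]
        rw [hg (m + t) (by omega), hQsucc]
        field_simp }
  -- Each weight is the increment of `1 / Q`. Multiplying the bound by `Q n` thus turns the total
  -- weight into `1 - Q n` and the largest weight into `η`.
  have htel : ∀ n, ∑ t ∈ Finset.range n, α (m + t + 1) / Q (t + 1) = 1 / Q n - 1 := by
    intro n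
    induction n with
    | zero => simp [hQ0]
    | succ n ihn =>
      have h1 := (hQpos n).ne'
      have h2 : 1 - α (m + n + 1) ≠ 0 := (sub_pos.2 (hα1 _ (by omega))).ne'
      rw [Finset.sum_range_succ, ihn, hQsucc]
      field_simp
      ring
  set c : ℝ := ∑ k ∈ I, ∑ l ∈ J, |f m k - g m l| with hc_def
  have hc : ∀ k ∈ I, ∀ l ∈ J, f m k - g m l ≤ c := fun k hk l hl =>
    (le_abs_self _).trans
      ((Finset.single_le_sum (f := fun l => |f m k - g m l|) (fun l _ => abs_nonneg _) hl).trans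
        (Finset.single_le_sum (f := fun k => ∑ l ∈ J, |f m k - g m l|)
          (fun k _ => Finset.sum_nonneg fun l _ => abs_nonneg _) hk))
  have hbound : ∀ n, ∀ k ∈ I, ∀ l ∈ J, f (m + n) k - g (m + n) l ≤ c * Q n + 2 * ε / 3 := by
    intro n k hk l hl
    have h1 := hC _ n _ _ _ _ _ (div_pos hη0 (hQpos n)) (hplay n) c
      (by simpa [hQ0] using hc) k hk l hl
    rw [htel, ← sub_div, div_le_iff₀ (hQpos n)] at h1
    have h2 : (c + ε / 3 * (1 / Q n - 1) + C * (η / Q n)) * Q n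
        = c * Q n + ε / 3 * (1 - Q n) + C * η := by
      have := (hQpos n).ne'
      field_simp
    rw [h2] at h1
    have h3 : 0 ≤ ε / 3 * Q n := mul_nonneg (by positivity) (hQpos n).le
    linarith
  have hlim : Tendsto (fun t => c * Q t) atTop (𝓝 0) := by
    simpa using (tendsto_retention hαsum hα1).const_mul c
  obtain ⟨t₀, ht₀⟩ := eventually_atTop.1
    (hlim.eventually (gt_mem_nhds (show (0 : ℝ) < ε / 3 by positivity)))
  filter_upwards [eventually_ge_atTop (m + t₀)] with n hn k hk l hl
  have h1 := hbound (n - m) k hk l hl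
  have h2 := ht₀ (n - m) (by omega)
  rw [Nat.add_sub_cancel' (by omega)] at h1
  linarith

/-! ### Linearity and boundedness of regret -/

section Regret

variable {T N : ℕ} (q : (Fin N → Fin T) → ℝ) (𝔻 : Set (Rule T N))

/-- The payoff as a linear functional of the rule. -/
noncomputable def payoffLinear (μ : Mean T) : Rule T N →ₗ[ℝ] ℝ where
  toFun δ := payoff q δ μ
  map_add' δ δ' := by
    simp only [payoff, Pi.add_apply, add_mul, Finset.sum_add_distrib, mul_add]
  map_smul' r δ := by
    simp only [payoff, Pi.smul_apply, smul_eq_mul, RingHom.id_apply, Finset.mul_sum]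
    exact Finset.sum_congr rfl fun w _ => Finset.sum_congr rfl fun b _ =>
      Finset.sum_congr rfl fun y _ => by ring

/-- Coefficients summing to 1 preserve the benchmark; no sign is required, as early 1 - α may be
negative. -/
lemma regret_combo (μ : Mean T) (δ δ' : Rule T N) {r s : ℝ} (hrs : r + s = 1) :
    regret q 𝔻 (r • δ + s • δ') μ = r * regret q 𝔻 δ μ + s * regret q 𝔻 δ' μ := by
  have h : payoff q (r • δ + s • δ') μ = r * payoff q δ μ + s * payoff q δ' μ := by
    change payoffLinear q μ (r • δ + s • δ') = r • payoffLinear q μ δ + s • payoffLinear q μ δ'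
    rw [map_add, map_smul, map_smul]
  obtain rfl : s = 1 - r := by linarith
  rw [regret, regret, regret, h]
  ring

lemma mixedRegret_combo (δ : Rule T N) (ν : NatureMix T) (μ : Mean T) (r s : ℝ) :
    mixedRegret q 𝔻 δ (r • ν + s • Finsupp.single μ (1 : ℝ))
      = r * mixedRegret q 𝔻 δ ν + s * regret q 𝔻 δ μ := by
  have h : ∀ ν : NatureMix T, mixedRegret q 𝔻 δ ν
      = Finsupp.linearCombination ℝ (regret q 𝔻 δ) ν := fun ν => by
    simp [mixedRegret, Finsupp.linearCombination_apply]
  rw [h, h, map_add, map_smul, map_smul, Finsupp.linearCombination_single]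
  simp

lemma mixedRegret_rule_combo (ν : NatureMix T) (δ δ' : Rule T N) {r s : ℝ} (hrs : r + s = 1) :
    mixedRegret q 𝔻 (r • δ + s • δ') ν
      = r * mixedRegret q 𝔻 δ ν + s * mixedRegret q 𝔻 δ' ν := by
  simp only [mixedRegret, Finsupp.sum, regret_combo q 𝔻 _ _ _ hrs, Finset.mul_sum,
    ← Finset.sum_add_distrib]
  exact Finset.sum_congr rfl fun μ _ => by ring

/-- Against any mixed strategy of nature, an optimal element of `D` is optimal in its convex
hull. -/
lemma le_mixedRegret_of_mem_convexHull {D : Set (Rule T N)} (ν : NatureMix T) {x : ℝ}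
    (hx : ∀ d ∈ D, x ≤ mixedRegret q 𝔻 d ν) {δ : Rule T N} (hδ : δ ∈ convexHull ℝ D) :
    x ≤ mixedRegret q 𝔻 δ ν := by
  have hconv : Convex ℝ {δ : Rule T N | x ≤ mixedRegret q 𝔻 δ ν} := by
    intro δ₁ h₁ δ₂ h₂ r s hr hs hrs
    simp only [Set.mem_ofPred_eq] at h₁ h₂ ⊢
    rw [mixedRegret_rule_combo q 𝔻 ν δ₁ δ₂ hrs]
    calc x = r * x + s * x := by rw [← add_mul, hrs, one_mul]
      _ ≤ _ := add_le_add (mul_le_mul_of_nonneg_left h₁ hr) (mul_le_mul_of_nonneg_left h₂ hs)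
  exact convexHull_min hx hconv hδ

/-- Compactness of the hull makes the benchmark a genuine supremum. The bound also keeps the `sInf`
defining the value from taking its default. -/
lemma regret_nonneg {D : Finset (Rule T N)} (μ : Mean T) {δ : Rule T N}
    (hδ : δ ∈ convexHull ℝ (D : Set (Rule T N))) :
    0 ≤ regret q (convexHull ℝ (D : Set (Rule T N))) δ μ := by
  have hcomp : IsCompact (convexHull ℝ (D : Set (Rule T N))) :=
    D.finite_toSet.isCompact_convexHull ℝ
  have hbdd : BddAbove ((fun d => payoff q d μ) '' convexHull ℝ (D : Set (Rule T N))) :=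
    (hcomp.image (payoffLinear (N := N) q μ).continuous_of_finiteDimensional).bddAbove
  exact sub_nonneg.2 (le_csSup hbdd ⟨δ, hδ, rfl⟩)

variable {q 𝔻} {Mε : Finset (Mean T)}

lemma regret_le_maxRegret (δ : Rule T N) {μ : Mean T} (hμ : μ ∈ Mε) :
    regret q 𝔻 δ μ ≤ maxRegret q 𝔻 Mε δ :=
  le_csSup (Mε.finite_toSet.image _).bddAbove ⟨μ, hμ, rfl⟩

lemma maxRegret_le (hne : Mε.Nonempty) {δ : Rule T N} {x : ℝ}
    (hx : ∀ μ ∈ Mε, regret q 𝔻 δ μ ≤ x) : maxRegret q 𝔻 Mε δ ≤ x := by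
  refine csSup_le (hne.to_set.image _) ?_
  rintro _ ⟨μ, hμ, rfl⟩
  exact hx μ hμ

lemma minimaxRegretValue_le {D : Finset (Rule T N)} (hne : Mε.Nonempty) {δ : Rule T N}
    (hδ : δ ∈ convexHull ℝ (D : Set (Rule T N))) :
    minimaxRegretValue q (convexHull ℝ (D : Set (Rule T N))) Mε
      ≤ maxRegret q (convexHull ℝ (D : Set (Rule T N))) Mε δ := by
  obtain ⟨μ, hμ⟩ := hne
  refine csInf_le ⟨0, ?_⟩ ⟨δ, hδ, rfl⟩
  rintro _ ⟨δ', hδ', rfl⟩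
  exact (regret_nonneg q μ hδ').trans (regret_le_maxRegret δ' hμ)

end Regret

/-! ### Fading of the early rounds of a run -/

namespace IsRun

variable {T N : ℕ} {q : (Fin N → Fin T) → ℝ} {𝔻 : Set (Rule T N)} {D : Finset (Rule T N)}
  {Mε : Finset (Mean T)} {α : ℕ → ℝ} {δ : ℕ → Rule T N} {ν : ℕ → NatureMix T}
  {μBR : ℕ → Mean T} {δBR : ℕ → Rule T N}

lemma regret_succ (h : IsRun q 𝔻 D Mε α δ ν μBR δBR) {n : ℕ} (hn : 1 ≤ n) (μ : Mean T) :
    regret q 𝔻 (δ (n + 1)) μ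
      = (1 - α (n + 1)) * regret q 𝔻 (δ n) μ + α (n + 1) * regret q 𝔻 (δBR n) μ := by
  rw [h.rule_update n hn, regret_combo q 𝔻 μ _ _ (by ring)]

lemma mixedRegret_succ (h : IsRun q 𝔻 D Mε α δ ν μBR δBR) (n : ℕ) (d : Rule T N) :
    mixedRegret q 𝔻 d (ν (n + 1))
      = (1 - α (n + 1)) * mixedRegret q 𝔻 d (ν n)
        + α (n + 1) * regret q 𝔻 d (μBR (n + 1)) := by
  rw [h.nature_update (n + 1) (by omega), mixedRegret_combo, Nat.add_sub_cancel]

/-- From a time on, the rules of a run stay close to the convex hull of `D`: the contribution of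
the state at time `m` fades at the rate `retention α m`. -/
lemma exists_mem_convexHull (h : IsRun q 𝔻 D Mε α δ ν μBR δBR) {m : ℕ} (hm : 1 ≤ m)
    (hα0 : ∀ n, m ≤ n → 0 < α n) (hα1 : ∀ n, m ≤ n → α n < 1) (t : ℕ) :
    ∃ e ∈ convexHull ℝ (D : Set (Rule T N)), ∀ μ, regret q 𝔻 (δ (m + t)) μ - regret q 𝔻 e μ
      = retention α m t * (regret q 𝔻 (δ m) μ - regret q 𝔻 (δ 1) μ) := by
  induction t with
  | zero => exact ⟨δ 1, subset_convexHull ℝ _ h.init_rule, fun μ => by simp [retention]⟩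
  | succ t ih =>
    obtain ⟨e, he, heq⟩ := ih
    have h0 := hα0 (m + t + 1) (by omega)
    have h1 := hα1 (m + t + 1) (by omega)
    refine ⟨(1 - α (m + t + 1)) • e + α (m + t + 1) • δBR (m + t),
      convex_convexHull ℝ _ he (subset_convexHull ℝ _ (h.rule_mem _ (by omega)))
        (by linarith) h0.le (by ring), fun μ => ?_⟩
    rw [← add_assoc, h.regret_succ (by omega), regret_combo q 𝔻 μ _ _ (by ring), retention_succ,
      mul_assoc, ← heq]
    ring

/-- Against the state of nature in a run, a rule does at most as badly as in the worst case, up to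
a vanishing contribution of the state at time `m`. -/
lemma mixedRegret_le (h : IsRun q 𝔻 D Mε α δ ν μBR δBR) {m : ℕ}
    (hα0 : ∀ n, m ≤ n → 0 < α n) (hα1 : ∀ n, m ≤ n → α n < 1) (d : Rule T N) (t : ℕ) :
    mixedRegret q 𝔻 d (ν (m + t)) - maxRegret q 𝔻 Mε d
      ≤ retention α m t * (mixedRegret q 𝔻 d (ν m) - maxRegret q 𝔻 Mε d) := by
  induction t with
  | zero => simp [retention]
  | succ t ih =>
    have h0 := hα0 (m + t + 1) (by omega)
    have h1 := hα1 (m + t + 1) (by omega)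
    have h2 := mul_le_mul_of_nonneg_left ih (sub_pos.2 h1).le
    have h3 := mul_le_mul_of_nonneg_left
      (regret_le_maxRegret (q := q) (𝔻 := 𝔻) d (h.nature_mem (m + t + 1) (by omega))) h0.le
    rw [← add_assoc, h.mixedRegret_succ, retention_succ, mul_assoc]
    linarith

end IsRun

end MinimaxRegret

/-! ### Convergence to the minimax value -/

open MinimaxRegret in
theorem proposition2 {T N : ℕ}
    (q : (Fin N → Fin T) → ℝ) (hq : q ∈ stdSimplex ℝ (Fin N → Fin T))
    (D : Finset (Rule T N)) (hD : ∀ d ∈ D, IsTreatmentRule d)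
    (𝔻 : Set (Rule T N)) (h𝔻 : 𝔻 = convexHull ℝ (D : Set (Rule T N)))
    (M : Set (Mean T)) (hM : ∀ μ ∈ M, ∀ t, μ t ∈ Set.Icc (0 : ℝ) 1) (hMne : M.Nonempty)
    (ε : ℝ) (hε : 0 < ε) (Mε : Finset (Mean T)) (hMε : IsDiscretization M ε Mε)
    (α : ℕ → ℝ) (hαpos : ∀ n, 1 ≤ n → 0 < α n)
    (hαlim : Tendsto α atTop (𝓝 0))
    (hαsum : Tendsto (fun n => ∑ k ∈ Finset.Icc 1 n, α k) atTop atTop)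
    (δ : ℕ → Rule T N) (ν : ℕ → NatureMix T) (μBR : ℕ → Mean T) (δBR : ℕ → Rule T N)
    (hrun : IsRun q 𝔻 D Mε α δ ν μBR δBR) :
    Tendsto (fun n => maxRegret q 𝔻 Mε (δ n)) atTop (𝓝 (minimaxRegretValue q 𝔻 Mε)) := by
  subst h𝔻
  set 𝔻 := convexHull ℝ (D : Set (Rule T N)) with h𝔻
  have hMεne : Mε.Nonempty := ⟨μBR 1, hrun.nature_mem 1 le_rfl⟩
  have hmem₁ : δ 1 ∈ 𝔻 := subset_convexHull ℝ _ hrun.init_rule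
  obtain ⟨m₀, hm₀⟩ := eventually_atTop.1 (hαlim.eventually (gt_mem_nhds one_pos))
  obtain ⟨m, hm, hα1⟩ : ∃ m, 1 ≤ m ∧ ∀ n, m ≤ n → α n < 1 :=
    ⟨m₀ + 1, by omega, fun n hn => hm₀ n (by omega)⟩
  have hα0 : ∀ n, m ≤ n → 0 < α n := fun n hn => hαpos n (by omega)
  have hQ := tendsto_retention hαsum hα1
  have hfade : ∀ (c r : ℝ), 0 < r → ∀ᶠ n in atTop, retention α m (n - m) * c < r := by
    intro c r hr
    have h := (hQ.comp (tendsto_sub_atTop_nat m)).mul_const c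
    rw [zero_mul] at h
    exact h.eventually (gt_mem_nhds hr)
  refine tendsto_order.2 ⟨fun x hx => ?_, fun x hx => ?_⟩
  -- Lower bound: `δ n` is compared with a nearby rule `e` of the hull.
  · set c : ℝ := ∑ μ ∈ Mε, |regret q 𝔻 (δ m) μ - regret q 𝔻 (δ 1) μ| with hc
    filter_upwards [hfade c _ (sub_pos.2 hx), eventually_ge_atTop m] with n hn hmn
    obtain ⟨e, he, heq⟩ := hrun.exists_mem_convexHull hm hα0 hα1 (n - m)
    rw [Nat.add_sub_cancel' hmn] at heq
    have hV : minimaxRegretValue q 𝔻 Mε ≤ maxRegret q 𝔻 Mε e := minimaxRegretValue_le hMεne he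
    have hle : maxRegret q 𝔻 Mε e ≤ maxRegret q 𝔻 Mε (δ n) + retention α m (n - m) * c := by
      refine maxRegret_le hMεne fun μ hμ => ?_
      have h1 := regret_le_maxRegret (q := q) (𝔻 := 𝔻) (δ n) hμ
      have h2 : -c ≤ regret q 𝔻 (δ m) μ - regret q 𝔻 (δ 1) μ :=
        (abs_le.1 (Finset.single_le_sum
          (f := fun μ => |regret q 𝔻 (δ m) μ - regret q 𝔻 (δ 1) μ|)
          (fun _ _ => abs_nonneg _) hμ)).1
      have h3 := mul_le_mul_of_nonneg_left h2 (retention_pos hα1 (n - m)).le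
      rw [← heq μ] at h3
      linarith
    linarith
  · obtain ⟨_, ⟨d, hd, rfl⟩, hdx⟩ := exists_lt_of_csInf_lt
      (Set.Nonempty.image (fun δ => maxRegret q 𝔻 Mε δ) ⟨δ 1, hmem₁⟩) hx
    -- Half of the slack pays for the gap, half for the early rounds.
    set r := (x - maxRegret q 𝔻 Mε d) / 2 with hr
    have hr0 : 0 < r := half_pos (sub_pos.2 hdx)
    have hgap := eventually_gap_le (fun μ d => regret q 𝔻 d μ) Mε D α hαpos hαlim hαsum
      (fun n μ => regret q 𝔻 (δ n) μ) (fun n d => mixedRegret q 𝔻 d (ν n)) μBR δBR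
      hrun.nature_mem hrun.nature_best hrun.rule_mem hrun.rule_best
      (fun n hn μ => hrun.regret_succ hn μ) (fun n _ d => hrun.mixedRegret_succ n d) hr0
    filter_upwards [hgap, hfade (mixedRegret q 𝔻 d (ν m) - maxRegret q 𝔻 Mε d) r hr0,
      eventually_ge_atTop m] with n hn hfn hmn
    have h1 := hrun.mixedRegret_le hα0 hα1 d (n - m)
    rw [Nat.add_sub_cancel' hmn] at h1
    have h2 := le_mixedRegret_of_mem_convexHull q 𝔻 (ν n) (hrun.rule_best n (by omega)) hd
    have h3 : maxRegret q 𝔻 Mε (δ n) ≤ mixedRegret q 𝔻 (δBR n) (ν n) + r :=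
      maxRegret_le hMεne fun μ hμ => by
        linarith [hn μ hμ (δBR n) (hrun.rule_mem n (by omega))]
    linarith
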